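/- **Lemma (A-stability of $(PsNsQ2sGau)$).** Let $s\ge 1$, let $0=d_0<d_1<\dots<d_s=1$ be control points with Lagrange basis polynomials $l_\nu$ (so $l_\nu(d_i)=\delta_{\nu i}$), and let $(b_i,c_i)_{i=1}^s$ be the $s$-point Gauss quadrature formula on $[0,1]$, i.e. the one with $s$ distinct nodes that is exact for all polynomials of degree at most $2s-1$. For a $C^2$ Lagrangian $L(q,\dot q)$ on a finite-dimensional real vector space $Q$ and a step size $h\neq 0$ put $$L_d(q^0,\dots,q^s)=h\sum_{i=1}^s b_i\,L\big(q_d(c_ih),\dot q_d(c_ih)\big),\qquad q_d(t)=\sum_{\nu=0}^s q^\nu\, l_\nu(t/h).$$ One step of the variational integrator $(PsNsQ2sGau)$ relates $(q_0,p_0)$ to $(q_1,p_1)$ if there are $q^0=q_0,\,q^1,\dots,q^{s-1},\,q^s=q_1$ in $Q$ with $$p_0=-\frac{\partial L_d}{\partial q^0},\qquad \frac{\partial L_d}{\partial q^\nu}=0\ \ (1\le\nu\le s-1),\qquad p_1=\frac{\partial L_d}{\partial q^s}$$ (the graph of the discrete Hamiltonian map). Then this integrator is A-stable, in the following sense. 1.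 For every such $Q$, $L$ and $h\ne0$, the step relation of the integrator coincides with that of the Runge–Kutta method with coefficients $a_{ij}=\int_0^{c_i}\ell_j$, $b_j=\int_0^1\ell_j$ (where $\ell_j$ is the Lagrange basis of the nodes $c_1,\dots,c_s$; this is Gauss–Legendre collocation), applied to the first-order system $p=\frac{\partial L}{\partial\dot q}(q,\dot q)$, $\dot p=\frac{\partial L}{\partial q}(q,\dot q)$ of the Lagrangian. Moreover this Runge–Kutta method is A-stable: for all $\mu\in\mathbb C$ with $\operatorname{Re}\mu\le 0$ and all $h>0$, its step for $y'=\mu y$ is well defined and is multiplication by a complex number $R$ with $|R|\le 1$. 2. In particular, there is no stability restriction on the step size: for the harmonic oscillator $L(q,\dot q)=\frac12\dot q^2-\frac12\omega^2q^2$ on $Q=\mathbb R$, for all real $\omega\ne0$ and $h\neq0$, the step of the integrator is well defined and given by $(p_1,\omega q_1)^T=M_{h,\omega}\,(p_0,\omega q_0)^T$ with an orthogonal matrix $M_{h,\omega}$. -/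

import Mathlib

open Polynomial

noncomputable section

/-- The `s`-point Gauss quadrature formula on `[0, 1]` with weights `b` and nodes `c`: the (unique)
formula with `s` nodes, listed increasingly, of order `2 s`, i.e. exact for all real polynomials of
degree at most `2 s - 1`. -/
def IsGaussQuadrature {s : ℕ} (b c : Fin s → ℝ) : Prop :=
  StrictMono c ∧
    ∀ P : ℝ[X], P.natDegree < 2 * s → ∑ i, b i * P.eval (c i) = ∫ x in (0 : ℝ)..1, P.eval x

/-! ### Galerkin variational integrators

Throughout, `d` are the `s + 1` control points, `(b, c)` is a quadrature formula with `r` points,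
`L (q, v)` is a Lagrangian on the configuration space `E`, and `h` is the step size. -/

section Galerkin

variable {E : Type*} [NormedAddCommGroup E] [NormedSpace ℝ E] {s r : ℕ}

/-- The interpolation polynomial `q_d(t; q, h) = ∑_ν l_ν(t / h) q^ν` of degree `s`, where `l_ν` are
the Lagrange basis polynomials of the control points `d`. -/
def interpCurve (d : Fin (s + 1) → ℝ) (h : ℝ) (q : Fin (s + 1) → E) (t : ℝ) : E :=
  ∑ ν, (Lagrange.basis Finset.univ d ν).eval (t / h) • q ν

/-- Its time derivative `(1 / h) ∑_ν l_ν'(t / h) q^ν`. -/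
def interpVelocity (d : Fin (s + 1) → ℝ) (h : ℝ) (q : Fin (s + 1) → E) (t : ℝ) : E :=
  (1 / h) • ∑ ν, (derivative (Lagrange.basis Finset.univ d ν)).eval (t / h) • q ν

/-- The discrete Lagrangian `L_d(q^0, …, q^s; h)`. -/
def discreteLagrangian (d : Fin (s + 1) → ℝ) (b c : Fin r → ℝ) (L : E × E → ℝ) (h : ℝ)
    (q : Fin (s + 1) → E) : ℝ :=
  h * ∑ i, b i * L (interpCurve d h q (c i * h), interpVelocity d h q (c i * h))

/-- The partial derivative `∂L_d / ∂q^ν`, a covector. -/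
def discreteLagrangianPartial (d : Fin (s + 1) → ℝ) (b c : Fin r → ℝ) (L : E × E → ℝ) (h : ℝ)
    (q : Fin (s + 1) → E) (ν : Fin (s + 1)) : E →L[ℝ] ℝ :=
  fderiv ℝ (fun x => discreteLagrangian d b c L h (Function.update q ν x)) (q ν)

/-- One step `(q₀, p₀) ↦ (q₁, p₁)` of the Galerkin variational integrator in phase space, i.e. the
graph of its discrete Hamiltonian map: there are configurations `q^0 = q₀, q^1, …, q^s = q₁`
satisfying the internal stage equations `∂L_d / ∂q^ν = 0` for `0 < ν < s`, and the discrete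
Legendre transforms give `p₀ = -∂L_d / ∂q^0` and `p₁ = ∂L_d / ∂q^s`. (Matching the momenta of
consecutive steps is the remaining discrete Euler-Lagrange equation.) -/
def VariationalStep (d : Fin (s + 1) → ℝ) (b c : Fin r → ℝ) (L : E × E → ℝ) (h : ℝ)
    (y₀ y₁ : E × (E →L[ℝ] ℝ)) : Prop :=
  ∃ q : Fin (s + 1) → E,
    q 0 = y₀.1 ∧ q (Fin.last s) = y₁.1 ∧
    (∀ ν, ν ≠ 0 → ν ≠ Fin.last s → discreteLagrangianPartial d b c L h q ν = 0) ∧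
    y₀.2 = -discreteLagrangianPartial d b c L h q 0 ∧
    y₁.2 = discreteLagrangianPartial d b c L h q (Fin.last s)

/-- The first-order system of the Lagrangian `L` on phase space, as the relation between a state
`y = (q, p)` and its slope `k = (q', p')`: `p = ∂L/∂v (q, q')` and `p' = ∂L/∂q (q, q')`.
When the Legendre transform of `L` is invertible, these are Hamilton's equations. -/
def lagrangianSystem (L : E × E → ℝ) (y k : E × (E →L[ℝ] ℝ)) : Prop :=
  y.2 = fderiv ℝ (fun v => L (y.1, v)) k.1 ∧ k.2 = fderiv ℝ (fun q => L (q, k.1)) y.1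

end Galerkin

/-! ### Runge-Kutta methods -/

/-- The coefficients of an `s`-stage Runge-Kutta method. -/
structure RungeKutta (s : ℕ) where
  A : Matrix (Fin s) (Fin s) ℝ
  b : Fin s → ℝ

/-- One Runge-Kutta step `y₀ ↦ y₁` of size `h` for the first-order system `F`; here `F y k` says
that `k` is the slope at the state `y` (for an ordinary differential equation `y' = f y`, this is
`k = f y`). `Y i` are the internal stages and `K i` the stage slopes. -/
def RungeKutta.Step {s : ℕ} (Φ : RungeKutta s) {V : Type*} [AddCommGroup V] [Module ℝ V]
    (F : V → V → Prop) (h : ℝ) (y₀ y₁ : V) : Prop :=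
  ∃ Y K : Fin s → V,
    (∀ i, F (Y i) (K i)) ∧
    (∀ i, Y i = y₀ + h • ∑ j, Φ.A i j • K j) ∧
    y₁ = y₀ + h • ∑ j, Φ.b j • K j

/-- A-stability: for the test equation `y' = μ y` with `Re μ ≤ 0` and every step size `h > 0`, the
step is well defined and is multiplication by a number `R` (the value of the stability function at
`h μ`) with `|R| ≤ 1`. -/
def RungeKutta.IsAStable {s : ℕ} (Φ : RungeKutta s) : Prop :=
  ∀ μ : ℂ, μ.re ≤ 0 → ∀ h : ℝ, 0 < h →
    ∃ R : ℂ, ‖R‖ ≤ 1 ∧ ∀ y₀ y₁ : ℂ, Φ.Step (fun y k => k = μ * y) h y₀ y₁ ↔ y₁ = R * y₀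

/-- The collocation method with nodes `c`, written as a Runge-Kutta method:
`a_ij = ∫₀^{c_i} ℓ_j` and `b_j = ∫₀¹ ℓ_j`, with `ℓ_j` the Lagrange basis of the nodes. -/
def collocation {s : ℕ} (c : Fin s → ℝ) : RungeKutta s where
  A := Matrix.of fun i j => ∫ x in (0 : ℝ)..c i, (Lagrange.basis Finset.univ c j).eval x
  b := fun j => ∫ x in (0 : ℝ)..1, (Lagrange.basis Finset.univ c j).eval x

/-- The Galerkin variational integrator with control points `d` and quadrature `(b, c)` is
equivalent to the Runge-Kutta method `Φ`: for every finite-dimensional configuration space and every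
`C²` Lagrangian both define the same one-step map (in the sense of graphs) on phase space. -/
def VariationalEquivalent {s r m : ℕ} (d : Fin (s + 1) → ℝ) (b c : Fin r → ℝ)
    (Φ : RungeKutta m) : Prop :=
  ∀ (E : Type) [NormedAddCommGroup E] [NormedSpace ℝ E] [FiniteDimensional ℝ E]
    (L : E × E → ℝ), ContDiff ℝ 2 L → ∀ h : ℝ, h ≠ 0 → ∀ y₀ y₁ : E × (E →L[ℝ] ℝ),
      VariationalStep d b c L h y₀ y₁ ↔ Φ.Step (lagrangianSystem L) h y₀ y₁

/-- The Lagrangian of the harmonic oscillator with frequency `ω`. -/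
def oscillatorLagrangian (ω : ℝ) (y : ℝ × ℝ) : ℝ :=
  1 / 2 * y.2 ^ 2 - 1 / 2 * ω ^ 2 * y.1 ^ 2

end

/-! Everything rests on one identity: `∑ b_i φ'(c_i) = φ(1) - φ(0)` for `deg φ ≤ 2s`, which is Gauss
exactness applied to `φ'` (`sum_derivative`). It admits products of two polynomials of degree `s`,
so it is a discrete integration by parts.

Equivalence: positions and momenta separate. A curve of degree `s` is determined by its initial
value and its velocities at the `s` nodes, which gives the position equations
(`exists_interpolation_iff`). The equations for `L_d` form a weak identity, linear in a test
polynomial of degree at most `s`. Testing with the basis `l_ν` gives the variational equations;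
testing with `1` and the antiderivatives of `ℓ_k` gives the Runge–Kutta momentum equations, by
`symplectic` and the positivity of the weights (`momentum_equations_iff`).

Stability: for `y' = z y`, the identity applied to `|y|²` gives `|y₁|² = |y₀|² + 2 Re z ∑ b_i
|Y_i|²`, hence `|R| ≤ 1`, with equality on the imaginary axis. Solvability of the stages is the
injectivity of `1 - zA` (`stages_eq_zero`). The oscillator is the case `z = i h ω` in the coordinate
`p + i ω q`, so its step is a rotation. -/

theorem integral_derivative_eval (φ : ℝ[X]) (x y : ℝ) :
    ∫ t in x..y, (derivative φ).eval t = φ.eval y - φ.eval x :=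
  intervalIntegral.integral_eq_sub_of_hasDerivAt (fun t _ => φ.hasDerivAt t)
    ((derivative φ).continuous.intervalIntegrable _ _)

theorem exists_derivative_eq {n : ℕ} (p : ℝ[X]) (hp : p.natDegree < n) :
    ∃ φ : ℝ[X], φ.natDegree ≤ n ∧ derivative φ = p ∧ φ.eval 0 = 0 := by
  refine ⟨∑ i ∈ Finset.range n, monomial (i + 1) (p.coeff i / (i + 1)), ?_, ?_, ?_⟩
  · refine natDegree_sum_le_of_forall_le _ _ fun i hi => ?_
    exact (natDegree_monomial_le _).trans (Finset.mem_range.1 hi)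
  · rw [derivative_sum]
    conv_rhs => rw [p.as_sum_range' n hp]
    refine Finset.sum_congr rfl fun i _ => ?_
    have : (i : ℝ) + 1 ≠ 0 := by positivity
    rw [derivative_monomial]
    congr 1
    push_cast
    field_simp
  · simp [eval_finsetSum]

theorem eval_lagrange_basis {n : ℕ} {x : Fin n → ℝ} (hx : Function.Injective x) (i j : Fin n) :
    (Lagrange.basis Finset.univ x j).eval (x i) = if i = j then 1 else 0 := by
  split_ifs with h
  · subst h
    exact Lagrange.eval_basis_self hx.injOn (Finset.mem_univ _)
  · exact Lagrange.eval_basis_of_ne (Ne.symm h) (Finset.mem_univ _)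

theorem natDegree_lagrange_basis {n : ℕ} {x : Fin n → ℝ} (hx : Function.Injective x) (j : Fin n) :
    (Lagrange.basis Finset.univ x j).natDegree < n := by
  have h := Lagrange.degree_basis hx.injOn (Finset.mem_univ j)
  rw [natDegree_eq_of_degree_eq_some h, Finset.card_univ, Fintype.card_fin]
  have := j.pos
  omega

theorem eq_sum_lagrange_basis {n : ℕ} {x : Fin n → ℝ} (hx : Function.Injective x) {p : ℝ[X]}
    (hp : p.natDegree < n) :
    p = ∑ j, C (p.eval (x j)) * Lagrange.basis Finset.univ x j := by
  have h := Lagrange.eq_interpolate (s := Finset.univ) (f := p) hx.injOn (by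
    rw [Finset.card_univ, Fintype.card_fin]
    exact (degree_le_natDegree).trans_lt (by exact_mod_cast hp))
  rwa [Lagrange.interpolate_apply] at h

/-! ### Collocation polynomials and Gauss quadrature -/

section Quadrature

variable {s : ℕ} {b c : Fin s → ℝ}

/-- Since `φ'` has degree below `s`, it equals its interpolant at the nodes; integrate from `0` to
`x`. The cases `x = c i` and `x = 1` produce the Runge–Kutta coefficients. -/
theorem eval_eq_add_integral_lagrange_basis (hs : 1 ≤ s) (hc : Function.Injective c) {φ : ℝ[X]}
    (hφ : φ.natDegree ≤ s) (x : ℝ) :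
    φ.eval x = φ.eval 0 +
      ∑ j, (∫ t in (0 : ℝ)..x, (Lagrange.basis Finset.univ c j).eval t) *
        (derivative φ).eval (c j) := by
  have hd : (derivative φ).natDegree < s := (natDegree_derivative_le φ).trans_lt (by omega)
  have h : ∀ t, (derivative φ).eval t =
      ∑ j, (Lagrange.basis Finset.univ c j).eval t * (derivative φ).eval (c j) := fun t => by
    conv_lhs => rw [eq_sum_lagrange_basis hc hd]
    simp [eval_finsetSum, mul_comm]
  have h' := integral_derivative_eval φ 0 x
  simp_rw [← intervalIntegral.integral_mul_const]
  rw [← intervalIntegral.integral_finsetSum, ← sub_eq_iff_eq_add', ← h']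
  · exact intervalIntegral.integral_congr fun t _ => h t
  · intro j _
    exact ((Polynomial.continuous _).mul continuous_const).intervalIntegrable _ _

theorem eval_node_eq_collocation (hs : 1 ≤ s) (hc : Function.Injective c) {φ : ℝ[X]}
    (hφ : φ.natDegree ≤ s) (i : Fin s) :
    φ.eval (c i) = φ.eval 0 + ∑ j, (collocation c).A i j * (derivative φ).eval (c j) :=
  eval_eq_add_integral_lagrange_basis hs hc hφ (c i)

theorem eval_one_eq_collocation (hs : 1 ≤ s) (hc : Function.Injective c) {φ : ℝ[X]}
    (hφ : φ.natDegree ≤ s) :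
    φ.eval 1 = φ.eval 0 + ∑ j, (collocation c).b j * (derivative φ).eval (c j) :=
  eval_eq_add_integral_lagrange_basis hs hc hφ 1

/-- The collocation polynomial with prescribed initial value and prescribed slopes at the nodes. -/
theorem exists_collocation_polynomial (hs : 1 ≤ s) (hc : Function.Injective c) (y : ℝ)
    (k : Fin s → ℝ) :
    ∃ φ : ℝ[X], φ.natDegree ≤ s ∧ φ.eval 0 = y ∧ (∀ i, (derivative φ).eval (c i) = k i) ∧
      (∀ i, φ.eval (c i) = y + ∑ j, (collocation c).A i j * k j) ∧
      φ.eval 1 = y + ∑ j, (collocation c).b j * k j := by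
  obtain ⟨φ, h1, h2, h3⟩ := exists_derivative_eq (n := s)
    (∑ j, C (k j) * Lagrange.basis Finset.univ c j) (by
      refine lt_of_le_of_lt (natDegree_sum_le_of_forall_le (n := s - 1) _ _ fun j _ => ?_)
        (by omega)
      have := natDegree_lagrange_basis hc j
      exact (natDegree_C_mul_le _ _).trans (by omega))
  have hdeg : (φ + C y).natDegree ≤ s := natDegree_add_le_of_degree_le h1 (by simp)
  have h0 : (φ + C y).eval 0 = y := by simp [h3]
  have hk : ∀ i, (derivative (φ + C y)).eval (c i) = k i := fun i => by
    simp [h2, eval_finsetSum, eval_lagrange_basis hc]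
  refine ⟨φ + C y, hdeg, h0, hk, fun i => ?_, ?_⟩
  · simpa only [h0, hk] using eval_node_eq_collocation hs hc hdeg i
  · simpa only [h0, hk] using eval_one_eq_collocation hs hc hdeg

namespace IsGaussQuadrature

theorem sum_derivative (hs : 1 ≤ s) (hG : IsGaussQuadrature b c) {φ : ℝ[X]}
    (hφ : φ.natDegree ≤ 2 * s) :
    ∑ i, b i * (derivative φ).eval (c i) = φ.eval 1 - φ.eval 0 := by
  rw [hG.2 _ ((natDegree_derivative_le φ).trans_lt (by omega)), integral_derivative_eval]

theorem collocation_b (hs : 1 ≤ s) (hG : IsGaussQuadrature b c) (i : Fin s) :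
    (collocation c).b i = b i := by
  have hc := hG.1.injective
  have h := hG.2 _ ((natDegree_lagrange_basis hc i).trans_le (by omega))
  rw [show (collocation c).b i = _ from h.symm]
  simp [eval_lagrange_basis hc]

/-- The formula is exact for `ℓ_i ^ 2`, of degree below `2s`, whose quadrature sum is `b i` and
whose integral is positive. -/
theorem weight_pos (hs : 1 ≤ s) (hG : IsGaussQuadrature b c) (i : Fin s) : 0 < b i := by
  have hc := hG.1.injective
  set l := Lagrange.basis Finset.univ c i with hl
  have hdeg : (l ^ 2).natDegree < 2 * s := by
    have : l.natDegree < s := natDegree_lagrange_basis hc i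
    rw [natDegree_pow]
    omega
  have h := hG.2 _ hdeg
  have hb : b i = ∫ x in (0 : ℝ)..1, (l ^ 2).eval x := by
    rw [← h]
    simp [hl, eval_lagrange_basis hc]
  have hl0 : l ≠ 0 := fun h0 => by
    have := eval_lagrange_basis hc i i
    rw [← hl, h0] at this
    simp at this
  obtain ⟨x, hx, hx'⟩ : ∃ x ∈ Set.Icc (0 : ℝ) 1, l.eval x ≠ 0 := by
    by_contra! hcon
    exact hl0 (eq_zero_of_infinite_isRoot l ((Set.Icc_infinite one_pos).mono hcon))
  rw [hb]
  refine intervalIntegral.integral_pos one_pos (Polynomial.continuous _).continuousOn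
    (fun t _ => ?_) ⟨x, hx, ?_⟩
  · rw [eval_pow]; positivity
  · rw [eval_pow]; positivity

/-- Symplecticity of Gauss collocation. -/
theorem symplectic (hs : 1 ≤ s) (hG : IsGaussQuadrature b c) (i j : Fin s) :
    b i * (collocation c).A i j + b j * (collocation c).A j i = b i * b j := by
  have hc := hG.1.injective
  obtain ⟨φ, h1, h2, h3, h4, h5⟩ := exists_collocation_polynomial hs hc 0 (Pi.single i 1)
  obtain ⟨ψ, k1, k2, k3, k4, k5⟩ := exists_collocation_polynomial hs hc 0 (Pi.single j 1)
  -- Here `φ' = ℓ_i` and `ψ' = ℓ_j` at the nodes, so the quadrature sum of `(φψ)'` is the left side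
  -- and `φ(1) ψ(1) = b_i b_j`.
  have h := hG.sum_derivative hs (φ := φ * ψ) (natDegree_mul_le.trans (by omega))
  simp only [derivative_mul, eval_add, eval_mul, h2, h3, h4, h5, k2, k3, k4, k5] at h
  simp only [Pi.single_apply, mul_ite, mul_one, mul_zero, Finset.sum_ite_eq', Finset.mem_univ,
    if_true, zero_add, hG.collocation_b hs, ite_mul, one_mul, zero_mul, mul_add,
    Finset.sum_add_distrib, sub_zero] at h
  linarith

/-- The discrete Hamilton principle in weak form is equivalent to the momentum equations of the
Gauss collocation method. -/
theorem momentum_equations_iff (hs : 1 ≤ s) (hG : IsGaussQuadrature b c) (h p₀ p₁ : ℝ)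
    (P G : Fin s → ℝ) :
    (∀ φ : ℝ[X], φ.natDegree ≤ s → φ.eval 1 * p₁ - φ.eval 0 * p₀ =
        ∑ i, b i * (h * φ.eval (c i) * G i + (derivative φ).eval (c i) * P i)) ↔
      (∀ i, P i = p₀ + h * ∑ j, (collocation c).A i j * G j) ∧
        p₁ = p₀ + h * ∑ j, b j * G j := by
  have hc := hG.1.injective
  constructor
  · intro H
    have hp₁ : p₁ = p₀ + h * ∑ j, b j * G j := by
      have h1 := H 1 (by simp)
      simp only [eval_one, one_mul, derivative_one, eval_zero, zero_mul, add_zero, mul_one] at h1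
      rw [← sub_eq_iff_eq_add', h1, Finset.mul_sum]
      exact Finset.sum_congr rfl fun i _ => by ring
    refine ⟨fun k => ?_, hp₁⟩
    -- This test function isolates `b k * P k`; symplecticity turns column `k` of `A` into row `k`,
    -- and `b k ≠ 0` is cancelled.
    obtain ⟨φ, h1, h2, h3, h4, h5⟩ := exists_collocation_polynomial hs hc 0 (Pi.single k 1)
    have h6 := H φ h1
    simp only [h2, h3, h4, h5, Pi.single_apply, mul_ite, mul_one, mul_zero, Finset.sum_ite_eq',
      Finset.mem_univ, if_true, zero_add, hG.collocation_b hs, ite_mul, one_mul, zero_mul,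
      mul_add, Finset.sum_add_distrib, sub_zero] at h6
    have h7 : ∑ i, b i * (h * (collocation c).A i k * G i) =
        b k * (h * ∑ j, b j * G j) - b k * (h * ∑ j, (collocation c).A k j * G j) := by
      simp only [Finset.mul_sum, ← Finset.sum_sub_distrib]
      refine Finset.sum_congr rfl fun i _ => ?_
      linear_combination (h * G i) * hG.symplectic hs i k
    have h8 := (hG.weight_pos hs k).ne'
    apply mul_left_cancel₀ h8
    rw [hp₁, h7] at h6
    linear_combination -h6
  · rintro ⟨hP, hp₁⟩ φ hφ
    have e1 : ∀ i, φ.eval (c i) = φ.eval 0 +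
        ∑ j, (collocation c).A i j * (derivative φ).eval (c j) :=
      eval_node_eq_collocation hs hc hφ
    have e2 := eval_one_eq_collocation hs hc hφ
    simp only [hG.collocation_b hs] at e2
    have e3 : ∑ i, b i * ((derivative φ).eval (c i) * P i) =
        (φ.eval 1 - φ.eval 0) * p₀ + h * ∑ j, b j * (φ.eval 1 - φ.eval (c j)) * G j := by
      -- Summation by parts: symplecticity in the form `b_j (b_i - a_ji) = b_i a_ij`.
      have e4 : ∀ j, b j * (φ.eval 1 - φ.eval (c j)) =
          ∑ i, b i * (derivative φ).eval (c i) * (collocation c).A i j := fun j => by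
        rw [e1 j, e2, add_sub_add_left_eq_sub, ← Finset.sum_sub_distrib, Finset.mul_sum]
        refine Finset.sum_congr rfl fun i _ => ?_
        linear_combination -(derivative φ).eval (c i) * hG.symplectic hs i j
      simp only [e4, Finset.sum_mul]
      rw [Finset.sum_comm, e2, add_sub_cancel_left, Finset.sum_mul, Finset.mul_sum,
        ← Finset.sum_add_distrib]
      refine Finset.sum_congr rfl fun i _ => ?_
      rw [hP i]
      simp only [mul_add, Finset.mul_sum]
      congr 1
      · ring
      · exact Finset.sum_congr rfl fun j _ => by ring
    simp only [mul_add, Finset.sum_add_distrib]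
    rw [e3, hp₁]
    have e5 : ∑ i, b i * (h * φ.eval (c i) * G i) +
        h * ∑ j, b j * (φ.eval 1 - φ.eval (c j)) * G j = φ.eval 1 * (h * ∑ j, b j * G j) := by
      simp only [Finset.mul_sum, ← Finset.sum_add_distrib]
      exact Finset.sum_congr rfl fun i _ => by ring
    linear_combination -e5

end IsGaussQuadrature

end Quadrature

/-! ### The linear test equation and A-stability -/

section TestEquation

variable {s : ℕ} {b c : Fin s → ℝ}

/-- Real and imaginary parts of the collocation polynomial of the test equation `y' = z y`. -/
theorem exists_test_equation_polynomials (hs : 1 ≤ s) (hc : Function.Injective c) {z y₀ : ℂ}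
    {Y : Fin s → ℂ} (hY : ∀ i, Y i = y₀ + ∑ j, ((collocation c).A i j : ℂ) * (z * Y j)) :
    ∃ u v : ℝ[X], u.natDegree ≤ s ∧ v.natDegree ≤ s ∧
      u.eval 0 = y₀.re ∧ v.eval 0 = y₀.im ∧
      (∀ i, u.eval (c i) = (Y i).re) ∧ (∀ i, v.eval (c i) = (Y i).im) ∧
      (∀ i, (derivative u).eval (c i) = (z * Y i).re) ∧
      (∀ i, (derivative v).eval (c i) = (z * Y i).im) ∧
      u.eval 1 = (y₀ + ∑ j, ((collocation c).b j : ℂ) * (z * Y j)).re ∧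
      v.eval 1 = (y₀ + ∑ j, ((collocation c).b j : ℂ) * (z * Y j)).im := by
  obtain ⟨u, u1, u2, u3, u4, u5⟩ := exists_collocation_polynomial hs hc y₀.re
    fun i => (z * Y i).re
  obtain ⟨v, v1, v2, v3, v4, v5⟩ := exists_collocation_polynomial hs hc y₀.im
    fun i => (z * Y i).im
  refine ⟨u, v, u1, v1, u2, v2, fun i => ?_, fun i => ?_, u3, v3, ?_, ?_⟩
  · rw [u4, hY i, Complex.add_re, Complex.re_sum]
    simp only [Complex.re_ofReal_mul]
  · rw [v4, hY i, Complex.add_im, Complex.im_sum]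
    simp only [Complex.im_ofReal_mul]
  · rw [u5, Complex.add_re, Complex.re_sum]
    simp only [Complex.re_ofReal_mul]
  · rw [v5, Complex.add_im, Complex.im_sum]
    simp only [Complex.im_ofReal_mul]

namespace IsGaussQuadrature

/-- The squared modulus `u² + v²` of the collocation polynomial has degree at most `2s`, and its
derivative at a node is `2 Re z |Y_i|²`. -/
theorem normSq_step (hs : 1 ≤ s) (hG : IsGaussQuadrature b c) {z y₀ : ℂ} {Y : Fin s → ℂ}
    (hY : ∀ i, Y i = y₀ + ∑ j, ((collocation c).A i j : ℂ) * (z * Y j)) :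
    Complex.normSq (y₀ + ∑ j, ((collocation c).b j : ℂ) * (z * Y j)) =
      Complex.normSq y₀ + 2 * z.re * ∑ i, b i * Complex.normSq (Y i) := by
  obtain ⟨u, v, hu, hv, u0, v0, uc, vc, uk, vk, u1, v1⟩ :=
    exists_test_equation_polynomials hs hG.1.injective hY
  have h := hG.sum_derivative hs (φ := u * u + v * v)
    (natDegree_add_le_of_degree_le (natDegree_mul_le.trans (by omega))
      (natDegree_mul_le.trans (by omega)))
  simp only [derivative_add, derivative_mul, eval_add, eval_mul, u0, v0, uc, vc, uk, vk] at h
  rw [Complex.normSq_apply, Complex.normSq_apply, ← u1, ← v1, Finset.mul_sum,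
    ← sub_eq_iff_eq_add', ← h]
  refine Finset.sum_congr rfl fun i _ => ?_
  rw [Complex.normSq_apply, Complex.mul_re, Complex.mul_im]
  ring

/-- For `Re z < 0` the norm identity with `y₀ = 0` forces `Y = 0`. For `Re z = 0` it carries no
information on `Y`, and a weighted modulus replaces it. -/
theorem stages_eq_zero (hs : 1 ≤ s) (hG : IsGaussQuadrature b c) {z : ℂ} (hz : z.re ≤ 0)
    {Y : Fin s → ℂ} (hY : ∀ i, Y i = ∑ j, ((collocation c).A i j : ℂ) * (z * Y j)) : Y = 0 := by
  have hY0 : ∀ i, Y i = 0 + ∑ j, ((collocation c).A i j : ℂ) * (z * Y j) := fun i => by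
    rw [zero_add, ← hY i]
  have key : ∀ w : Fin s → ℝ, (∀ i, 0 ≤ w i) → ∑ i, b i * w i = 0 → ∀ i, w i = 0 := by
    intro w hw h i
    have h1 := (Finset.sum_eq_zero_iff_of_nonneg fun i _ =>
      mul_nonneg (hG.weight_pos hs i).le (hw i)).1 h i (Finset.mem_univ _)
    exact (mul_eq_zero.1 h1).resolve_left (hG.weight_pos hs i).ne'
  rcases hz.lt_or_eq with hz | hz
  · have h := hG.normSq_step hs hY0
    have h1 := Complex.normSq_nonneg (0 + ∑ j, ((collocation c).b j : ℂ) * (z * Y j))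
    have h2 : 0 ≤ ∑ i, b i * Complex.normSq (Y i) := Finset.sum_nonneg fun i _ =>
      mul_nonneg (hG.weight_pos hs i).le (Complex.normSq_nonneg _)
    rw [h, Complex.normSq_zero] at h1
    ext i
    exact Complex.normSq_eq_zero.1 (key _ (fun i => Complex.normSq_nonneg _) (by nlinarith) i)
  · obtain ⟨u, v, hu, hv, u0, v0, uc, vc, uk, vk, -, -⟩ :=
      exists_test_equation_polynomials hs hG.1.injective hY0
    obtain ⟨f, rfl⟩ : X ∣ u := X_dvd_iff.2 (by rw [coeff_zero_eq_eval_zero, u0, Complex.zero_re])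
    obtain ⟨g, rfl⟩ : X ∣ v := X_dvd_iff.2 (by rw [coeff_zero_eq_eval_zero, v0, Complex.zero_im])
    have hdeg : ∀ f : ℝ[X], (X * f).natDegree ≤ s → f.natDegree ≤ s - 1 := fun f hf => by
      rcases eq_or_ne f 0 with rfl | h0
      · simp
      · rw [natDegree_X_mul h0] at hf
        omega
    have hf := hdeg f hu
    have hg := hdeg g hv
    -- With `u = X f`, `v = X g`, this polynomial is `((1 - x) / x) (u² + v²)`. It vanishes at `0`
    -- and `1`, and since `u u' + v v' = 0` at the nodes, its derivative there is `-(f² + g²)`.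
    have hφ : (X * (1 - X) * (f * f + g * g)).natDegree ≤ 2 * s := by
      have h1 : (X * (1 - X) : ℝ[X]).natDegree ≤ 2 := by compute_degree
      have h2 : (f * f + g * g).natDegree ≤ 2 * (s - 1) :=
        natDegree_add_le_of_degree_le (natDegree_mul_le.trans (by omega))
          (natDegree_mul_le.trans (by omega))
      exact natDegree_mul_le.trans (by omega)
    have h := hG.sum_derivative hs hφ
    simp only [derivative_mul, derivative_add, derivative_sub, derivative_X, derivative_one,
      eval_add, eval_mul, eval_sub, eval_X, eval_one, one_mul, zero_sub, sub_self, mul_zero,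
      zero_mul] at h uc vc uk vk
    have h' : ∑ i, b i * (f.eval (c i) ^ 2 + g.eval (c i) ^ 2) = 0 := by
      refine neg_eq_zero.1 (Eq.trans ?_ h)
      rw [← Finset.sum_neg_distrib]
      refine Finset.sum_congr rfl fun i _ => ?_
      have e1 := uk i
      have e2 := vk i
      rw [Complex.mul_re, hz, ← uc, ← vc] at e1
      rw [Complex.mul_im, hz, ← uc, ← vc] at e2
      simp only [eval_neg, eval_one]
      linear_combination (-2 * b i * (1 - c i)) * (f.eval (c i) * e1 + g.eval (c i) * e2)
    have h0 := key _ (fun i => by positivity) h'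
    ext i
    apply Complex.ext
    · rw [← uc, show f.eval (c i) = 0 by nlinarith [h0 i, sq_nonneg (g.eval (c i))]]
      simp
    · rw [← vc, show g.eval (c i) = 0 by nlinarith [h0 i, sq_nonneg (f.eval (c i))]]
      simp

/-- The stability function of Gauss collocation on the closed left half-plane. -/
theorem exists_stability_value (hs : 1 ≤ s) (hG : IsGaussQuadrature b c) {z : ℂ}
    (hz : z.re ≤ 0) :
    ∃ R : ℂ, ‖R‖ ≤ 1 ∧ (z.re = 0 → ‖R‖ = 1) ∧ ∀ y₀ y₁ : ℂ,
      (∃ Y : Fin s → ℂ, (∀ i, Y i = y₀ + ∑ j, ((collocation c).A i j : ℂ) * (z * Y j)) ∧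
        y₁ = y₀ + ∑ j, ((collocation c).b j : ℂ) * (z * Y j)) ↔ y₁ = R * y₀ := by
  let T : (Fin s → ℂ) →ₗ[ℂ] (Fin s → ℂ) :=
    LinearMap.pi fun i => LinearMap.proj i -
      ∑ j, ((collocation c).A i j : ℂ) • z • LinearMap.proj j
  have hT : ∀ Y i, T Y i = Y i - ∑ j, ((collocation c).A i j : ℂ) * (z * Y j) := fun Y i => by
    simp [T]
  have hinj : Function.Injective T := by
    refine (injective_iff_map_eq_zero T).2 fun Y hY => hG.stages_eq_zero hs hz fun i => ?_
    rw [← sub_eq_zero, ← hT, hY, Pi.zero_apply]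
  obtain ⟨W, hW⟩ := LinearMap.injective_iff_surjective.1 hinj 1
  have hW' : ∀ i, W i = 1 + ∑ j, ((collocation c).A i j : ℂ) * (z * W j) := fun i => by
    rw [← sub_eq_iff_eq_add, ← hT, hW, Pi.one_apply]
  have hR := hG.normSq_step hs hW'
  rw [Complex.normSq_one, Complex.normSq_eq_norm_sq] at hR
  have hpos : 0 ≤ ∑ i, b i * Complex.normSq (W i) := Finset.sum_nonneg fun i _ =>
    mul_nonneg (hG.weight_pos hs i).le (Complex.normSq_nonneg _)
  refine ⟨1 + ∑ j, ((collocation c).b j : ℂ) * (z * W j), ?_, fun h0 => ?_, fun y₀ y₁ => ?_⟩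
  · rw [← sq_le_one_iff₀ (norm_nonneg _), hR]
    nlinarith
  · rw [← pow_eq_one_iff_of_nonneg (norm_nonneg _) two_ne_zero, hR, h0]
    simp
  · have hmul : ∀ a : Fin s → ℝ, ∑ j, (a j : ℂ) * (z * (y₀ * W j)) =
        y₀ * ∑ j, (a j : ℂ) * (z * W j) := fun a => by
      rw [Finset.mul_sum]
      exact Finset.sum_congr rfl fun j _ => by ring
    constructor
    · rintro ⟨Y, hY, rfl⟩
      have : Y = y₀ • W := hinj <| by
        rw [map_smul, hW]
        ext i
        rw [hT, sub_eq_iff_eq_add.2 (hY i)]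
        simp
      subst this
      simp only [Pi.smul_apply, smul_eq_mul, hmul]
      ring
    · rintro rfl
      refine ⟨fun i => y₀ * W i, fun i => ?_, ?_⟩
      · rw [hmul]
        linear_combination y₀ * hW' i
      · rw [hmul]
        ring

theorem collocation_isAStable (hs : 1 ≤ s) (hG : IsGaussQuadrature b c) :
    (collocation c).IsAStable := by
  intro μ hμ h hh
  obtain ⟨R, hR, -, hstep⟩ := hG.exists_stability_value hs (z := h * μ)
    (by rw [Complex.re_ofReal_mul]; exact mul_nonpos_of_nonneg_of_nonpos hh.le hμ)
  refine ⟨R, hR, fun y₀ y₁ => ?_⟩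
  rw [← hstep]
  have hsum : ∀ (a : Fin s → ℝ) (Y : Fin s → ℂ),
      h • ∑ j, a j • (μ * Y j) = ∑ j, (a j : ℂ) * (h * μ * Y j) := fun a Y => by
    rw [Finset.smul_sum]
    refine Finset.sum_congr rfl fun j _ => ?_
    simp only [Complex.real_smul]
    ring
  constructor
  · rintro ⟨Y, K, hK, hY, hy⟩
    simp only [hK, hsum] at hY hy
    exact ⟨Y, hY, hy⟩
  · rintro ⟨Y, hY, hy⟩
    refine ⟨Y, fun i => μ * Y i, fun i => rfl, fun i => ?_, ?_⟩
    · rw [hsum, ← hY]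
    · rw [hsum, ← hy]

end IsGaussQuadrature

end TestEquation

/-! ### Derivatives of the discrete Lagrangian -/

section Galerkin

variable {E : Type*} [NormedAddCommGroup E] [NormedSpace ℝ E] {s : ℕ}

theorem sum_smul_update {n : ℕ} (f : Fin n → ℝ) (q : Fin n → E) (ν : Fin n) (x : E) :
    ∑ μ, f μ • Function.update q ν x μ = ∑ μ, f μ • q μ + f ν • (x - q ν) := by
  rw [← sub_eq_iff_eq_add', ← Finset.sum_sub_distrib, Finset.sum_eq_single ν]
  · simp [smul_sub]
  · intro μ _ h
    simp [h]
  · simp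

/-- Chain rule: curve and velocity are affine in each `q ν`. The outer `h` cancels the `1 / h` of
the velocity, so it survives only on the `∂L/∂q` term. -/
theorem discreteLagrangianPartial_eq {r : ℕ} (d : Fin (s + 1) → ℝ) (b c : Fin r → ℝ)
    {L : E × E → ℝ} (hL : Differentiable ℝ L) {h : ℝ} (hh : h ≠ 0) (q : Fin (s + 1) → E)
    (ν : Fin (s + 1)) :
    discreteLagrangianPartial d b c L h q ν =
      ∑ i, b i • ((h * (Lagrange.basis Finset.univ d ν).eval (c i)) •
          fderiv ℝ (fun x => L (x, interpVelocity d h q (c i * h)))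
            (interpCurve d h q (c i * h)) +
        (derivative (Lagrange.basis Finset.univ d ν)).eval (c i) •
          fderiv ℝ (fun v => L (interpCurve d h q (c i * h), v))
            (interpVelocity d h q (c i * h))) := by
  have key : ∀ i, HasFDerivAt
      (fun x => L (interpCurve d h (Function.update q ν x) (c i * h),
        interpVelocity d h (Function.update q ν x) (c i * h)))
      ((Lagrange.basis Finset.univ d ν).eval (c i) •
          fderiv ℝ (fun x => L (x, interpVelocity d h q (c i * h)))
            (interpCurve d h q (c i * h)) +
        ((1 / h) * (derivative (Lagrange.basis Finset.univ d ν)).eval (c i)) •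
          fderiv ℝ (fun v => L (interpCurve d h q (c i * h), v))
            (interpVelocity d h q (c i * h))) (q ν) := by
    intro i
    have hQ : (fun x => interpCurve d h (Function.update q ν x) (c i * h)) = fun x =>
        interpCurve d h q (c i * h) +
          (Lagrange.basis Finset.univ d ν).eval (c i) • (x - q ν) := by
      ext x
      simp only [interpCurve, mul_div_cancel_right₀ _ hh, sum_smul_update]
    have hV : (fun x => interpVelocity d h (Function.update q ν x) (c i * h)) = fun x =>
        interpVelocity d h q (c i * h) +
          ((1 / h) * (derivative (Lagrange.basis Finset.univ d ν)).eval (c i)) •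
            (x - q ν) := by
      ext x
      simp only [interpVelocity, mul_div_cancel_right₀ _ hh, sum_smul_update, smul_add, mul_smul]
    have hlin : ∀ (a : ℝ) (e : E), HasFDerivAt (fun x => e + a • (x - q ν))
        (a • ContinuousLinearMap.id ℝ E) (q ν) := fun a e =>
      (((hasFDerivAt_id (q ν)).sub_const (q ν)).const_smul a).const_add e
    have hQ' := hlin ((Lagrange.basis Finset.univ d ν).eval (c i))
      (interpCurve d h q (c i * h))
    have hV' := hlin ((1 / h) * (derivative (Lagrange.basis Finset.univ d ν)).eval (c i))
      (interpVelocity d h q (c i * h))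
    rw [← hQ] at hQ'
    rw [← hV] at hV'
    set Q := interpCurve d h q (c i * h)
    set V := interpVelocity d h q (c i * h)
    have hLQV : HasFDerivAt L (fderiv ℝ L (Q, V)) (Q, V) := (hL _).hasFDerivAt
    have hLQ : HasFDerivAt (fun x => L (x, V))
        ((fderiv ℝ L (Q, V)).comp (ContinuousLinearMap.inl ℝ E E)) Q :=
      hLQV.comp Q (hasFDerivAt_prodMk_left Q V)
    have hLV : HasFDerivAt (fun v => L (Q, v))
        ((fderiv ℝ L (Q, V)).comp (ContinuousLinearMap.inr ℝ E E)) V :=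
      hLQV.comp V (hasFDerivAt_prodMk_right Q V)
    have hcomp := HasFDerivAt.comp (g := L) (q ν)
      (by simpa only [Function.update_eq_self] using hLQV) (hQ'.prodMk hV')
    rw [hLQ.fderiv, hLV.fderiv]
    refine hcomp.congr_fderiv ?_
    ext e
    simp only [ContinuousLinearMap.comp_apply,
      add_apply, smul_apply,
      ContinuousLinearMap.prod_apply, ContinuousLinearMap.id_apply,
      ContinuousLinearMap.inl_apply, ContinuousLinearMap.inr_apply]
    rw [← map_smul, ← map_smul, ← map_add]
    simp [Q, V]
  unfold discreteLagrangianPartial discreteLagrangian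
  rw [((HasFDerivAt.fun_sum fun i _ => (key i).const_mul (b i)).const_mul h).fderiv,
    Finset.smul_sum]
  refine Finset.sum_congr rfl fun i _ => ?_
  ext e
  simp only [add_apply, smul_apply, smul_eq_mul]
  field_simp

end Galerkin

/-! ### Equivalence of the variational and Runge–Kutta steps -/

section Equivalence

variable {E : Type*} [NormedAddCommGroup E] [NormedSpace ℝ E] {s : ℕ}
  {d : Fin (s + 1) → ℝ} {b c : Fin s → ℝ}

theorem eval_derivative_eq_sum_lagrange_basis {n : ℕ} {x : Fin n → ℝ} (hx : Function.Injective x)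
    {p : ℝ[X]} (hp : p.natDegree < n) (t : ℝ) :
    (derivative p).eval t =
      ∑ j, (derivative (Lagrange.basis Finset.univ x j)).eval t * p.eval (x j) := by
  conv_lhs => rw [eq_sum_lagrange_basis hx hp]
  simp [eval_finsetSum, mul_comm]

theorem eval_eq_sum_lagrange_basis {n : ℕ} {x : Fin n → ℝ} (hx : Function.Injective x)
    {p : ℝ[X]} (hp : p.natDegree < n) (t : ℝ) :
    p.eval t = ∑ j, (Lagrange.basis Finset.univ x j).eval t * p.eval (x j) := by
  conv_lhs => rw [eq_sum_lagrange_basis hx hp]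
  simp [eval_finsetSum, mul_comm]

/-- Transfers a scalar identity to `E`-valued curves by applying it to each `l_ν`; `d 0 = 0` makes
`l_ν(0)` select `q 0`. -/
theorem sum_lagrange_basis_smul (hd : Function.Injective d) (hd0 : d 0 = 0) {h : ℝ} (hh : h ≠ 0)
    (q : Fin (s + 1) → E) {x : ℝ} {a : Fin s → ℝ}
    (ha : ∀ φ : ℝ[X], φ.natDegree ≤ s →
      φ.eval x = φ.eval 0 + ∑ j, a j * (derivative φ).eval (c j)) :
    ∑ ν, (Lagrange.basis Finset.univ d ν).eval x • q ν =
      q 0 + h • ∑ j, a j • interpVelocity d h q (c j * h) := by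
  have h1 : ∀ ν, (Lagrange.basis Finset.univ d ν).eval x • q ν =
      (if (0 : Fin (s + 1)) = ν then 1 else 0 : ℝ) • q ν +
        ∑ j, (a j * (derivative (Lagrange.basis Finset.univ d ν)).eval (c j)) • q ν := fun ν => by
    rw [← Finset.sum_smul, ← add_smul, ← eval_lagrange_basis hd, hd0,
      ← ha _ (Nat.lt_succ_iff.1 (natDegree_lagrange_basis hd ν))]
  simp only [h1, Finset.sum_add_distrib]
  congr 1
  · simp
  · rw [Finset.sum_comm, Finset.smul_sum]
    refine Finset.sum_congr rfl fun j _ => ?_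
    rw [interpVelocity, mul_div_cancel_right₀ _ hh, smul_comm, smul_smul h,
      mul_one_div_cancel hh, one_smul, Finset.smul_sum]
    simp only [mul_smul]

theorem exists_interpolation_iff (hs : 1 ≤ s) (hd : Function.Injective d) (hd0 : d 0 = 0)
    (hd1 : d (Fin.last s) = 1) (hc : Function.Injective c) {h : ℝ} (hh : h ≠ 0) (q₀ q₁ : E)
    (Q V : Fin s → E) :
    (∃ q : Fin (s + 1) → E, q 0 = q₀ ∧ q (Fin.last s) = q₁ ∧
      (∀ i, interpCurve d h q (c i * h) = Q i) ∧ ∀ i, interpVelocity d h q (c i * h) = V i) ↔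
    (∀ i, Q i = q₀ + h • ∑ j, (collocation c).A i j • V j) ∧
      q₁ = q₀ + h • ∑ j, (collocation c).b j • V j := by
  have hQ : ∀ q : Fin (s + 1) → E, ∀ i, interpCurve d h q (c i * h) =
      q 0 + h • ∑ j, (collocation c).A i j • interpVelocity d h q (c j * h) := fun q i => by
    rw [interpCurve, mul_div_cancel_right₀ _ hh]
    exact sum_lagrange_basis_smul hd hd0 hh q fun φ hφ => eval_node_eq_collocation hs hc hφ i
  constructor
  · rintro ⟨q, rfl, rfl, hQ', hV⟩
    refine ⟨fun i => ?_, ?_⟩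
    · simp only [← hQ', ← hV, ← hQ]
    · simp only [← hV]
      rw [← sum_lagrange_basis_smul hd hd0 hh q fun φ hφ => eval_one_eq_collocation hs hc hφ]
      have h1 : ∀ ν, (Lagrange.basis Finset.univ d ν).eval 1 =
          if Fin.last s = ν then 1 else 0 := fun ν => by
        rw [← eval_lagrange_basis hd, hd1]
      simp [h1]
  · rintro ⟨hQ', rfl⟩
    choose ψ ψdeg ψ0 ψk _ ψ1 using fun j : Fin s =>
      exists_collocation_polynomial hs hc 0 (Pi.single j 1)
    -- The collocation curve with slopes `V`, sampled at the control points; having degree at most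
    -- `s`, it is recovered exactly by interpolation there.
    let q : Fin (s + 1) → E := fun ν => q₀ + h • ∑ j, (ψ j).eval (d ν) • V j
    have hq0 : q 0 = q₀ := by simp [q, hd0, ψ0]
    have hV : ∀ i, interpVelocity d h q (c i * h) = V i := fun i => by
      have e1 : ∑ ν, (derivative (Lagrange.basis Finset.univ d ν)).eval (c i) = 0 := by
        have := eval_derivative_eq_sum_lagrange_basis hd (p := 1) (by simp) (c i)
        simpa using this.symm
      have e2 : ∀ j, ∑ ν, (derivative (Lagrange.basis Finset.univ d ν)).eval (c i) *
          (ψ j).eval (d ν) = if i = j then 1 else 0 := fun j => by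
        rw [← eval_derivative_eq_sum_lagrange_basis hd (Nat.lt_succ_of_le (ψdeg j)), ψk,
          Pi.single_apply]
      rw [interpVelocity, mul_div_cancel_right₀ _ hh]
      simp only [q, smul_add, Finset.sum_add_distrib, ← Finset.sum_smul, e1, zero_smul, zero_add]
      simp only [smul_comm _ h, ← Finset.smul_sum]
      rw [smul_smul, mul_one_div_cancel hh, one_smul]
      simp only [Finset.smul_sum, smul_smul]
      rw [Finset.sum_comm]
      simp only [← Finset.sum_smul, e2]
      simp
    refine ⟨q, hq0, ?_, fun i => ?_, hV⟩
    · simp only [q, hd1, ψ1, Pi.single_apply]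
      simp
    · rw [hQ, hq0, hQ' i]
      simp only [hV]

namespace IsGaussQuadrature

/-- `D ν` is the right side of the weak identity at `φ = l_ν`, and the `l_ν` span the test
polynomials. As `l_ν(0)` and `l_ν(1)` are Kronecker deltas, only the first and last `ν` see the
momenta. -/
theorem boundary_equations_iff (hs : 1 ≤ s) (hG : IsGaussQuadrature b c)
    (hd : Function.Injective d) (hd0 : d 0 = 0) (hd1 : d (Fin.last s) = 1) (h p₀ p₁ : ℝ)
    (P G : Fin s → ℝ) (D : Fin (s + 1) → ℝ)
    (hD : ∀ ν, D ν = ∑ i, b i * (h * (Lagrange.basis Finset.univ d ν).eval (c i) * G i +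
      (derivative (Lagrange.basis Finset.univ d ν)).eval (c i) * P i)) :
    ((∀ ν, ν ≠ 0 → ν ≠ Fin.last s → D ν = 0) ∧ p₀ = -D 0 ∧ p₁ = D (Fin.last s)) ↔
      (∀ i, P i = p₀ + h * ∑ j, (collocation c).A i j * G j) ∧
        p₁ = p₀ + h * ∑ j, (collocation c).b j * G j := by
  simp only [hG.collocation_b hs]
  rw [← hG.momentum_equations_iff hs]
  have h0l : (0 : Fin (s + 1)) ≠ Fin.last s := fun h0 => by
    rw [h0, hd1] at hd0
    exact one_ne_zero hd0
  constructor
  · rintro ⟨H, rfl, rfl⟩ φ hφ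
    have hφ' := Nat.lt_succ_of_le hφ
    have e : ∑ ν, φ.eval (d ν) * D ν = φ.eval (d 0) * D 0 +
        φ.eval (d (Fin.last s)) * D (Fin.last s) :=
      Fintype.sum_eq_add _ _ h0l fun ν hν => by rw [H ν hν.1 hν.2, mul_zero]
    rw [hd0, hd1] at e
    rw [mul_neg, sub_neg_eq_add, add_comm, ← e]
    simp only [hD, Finset.mul_sum]
    rw [Finset.sum_comm]
    refine Finset.sum_congr rfl fun i _ => ?_
    rw [eval_eq_sum_lagrange_basis hd hφ' (c i),
      eval_derivative_eq_sum_lagrange_basis hd hφ' (c i)]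
    simp only [Finset.mul_sum, Finset.sum_mul, ← Finset.sum_add_distrib]
    exact Finset.sum_congr rfl fun ν _ => by ring
  · intro H
    have e : ∀ ν, (if Fin.last s = ν then 1 else 0) * p₁ - (if 0 = ν then 1 else 0) * p₀ =
        D ν := fun ν => by
      rw [hD, ← H _ (Nat.lt_succ_iff.1 (natDegree_lagrange_basis hd ν)),
        ← eval_lagrange_basis hd, ← eval_lagrange_basis hd, hd0, hd1]
    refine ⟨fun ν h0 h1 => ?_, ?_, ?_⟩
    · rw [← e, if_neg h1.symm, if_neg h0.symm]
      ring
    · rw [← e, if_neg h0l.symm, if_pos rfl]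
      ring
    · rw [← e, if_neg h0l, if_pos rfl]
      ring

theorem boundary_equations_iff_dual (hs : 1 ≤ s) (hG : IsGaussQuadrature b c)
    (hd : Function.Injective d) (hd0 : d 0 = 0) (hd1 : d (Fin.last s) = 1) (h : ℝ)
    (p₀ p₁ : E →L[ℝ] ℝ) (P G : Fin s → E →L[ℝ] ℝ) (D : Fin (s + 1) → E →L[ℝ] ℝ)
    (hD : ∀ ν, D ν = ∑ i, b i • ((h * (Lagrange.basis Finset.univ d ν).eval (c i)) • G i +
      (derivative (Lagrange.basis Finset.univ d ν)).eval (c i) • P i)) :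
    ((∀ ν, ν ≠ 0 → ν ≠ Fin.last s → D ν = 0) ∧ p₀ = -D 0 ∧ p₁ = D (Fin.last s)) ↔
      (∀ i, P i = p₀ + h • ∑ j, (collocation c).A i j • G j) ∧
        p₁ = p₀ + h • ∑ j, (collocation c).b j • G j := by
  -- The equations are linear in the covectors, so they may be tested on each vector `e`.
  have key := fun e : E => hG.boundary_equations_iff hs hd hd0 hd1 h (p₀ e) (p₁ e)
    (fun i => P i e) (fun i => G i e) (fun ν => D ν e) fun ν => by rw [hD]; simp [mul_add]
  constructor
  · rintro ⟨h1, h2, h3⟩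
    have k := fun e => (key e).1 ⟨fun ν a b => by rw [h1 ν a b]; rfl, by rw [h2]; rfl, by rw [h3]⟩
    refine ⟨fun i => ?_, ?_⟩
    · ext e
      simpa using (k e).1 i
    · ext e
      simpa using (k e).2
  · rintro ⟨h1, h2⟩
    have k := fun e => (key e).2 ⟨fun i => by rw [h1 i]; simp, by rw [h2]; simp⟩
    refine ⟨fun ν a b => ?_, ?_, ?_⟩
    · ext e
      exact (k e).1 ν a b
    · ext e
      exact (k e).2.1
    · ext e
      exact (k e).2.2

theorem variationalStep_iff (hs : 1 ≤ s) (hG : IsGaussQuadrature b c)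
    (hd : Function.Injective d) (hd0 : d 0 = 0) (hd1 : d (Fin.last s) = 1) {L : E × E → ℝ}
    (hL : Differentiable ℝ L) {h : ℝ} (hh : h ≠ 0) (y₀ y₁ : E × (E →L[ℝ] ℝ)) :
    VariationalStep d b c L h y₀ y₁ ↔ (collocation c).Step (lagrangianSystem L) h y₀ y₁ := by
  have hc := hG.1.injective
  constructor
  · rintro ⟨q, h0, h1, hD⟩
    have hmom := (hG.boundary_equations_iff_dual hs hd hd0 hd1 h y₀.2 y₁.2 _ _ _
      (discreteLagrangianPartial_eq d b c hL hh q)).1 hD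
    have hpos := (exists_interpolation_iff hs hd hd0 hd1 hc hh y₀.1 y₁.1 _ _).1
      ⟨q, h0, h1, fun i => rfl, fun i => rfl⟩
    refine ⟨fun i => (interpCurve d h q (c i * h),
        fderiv ℝ (fun v => L (interpCurve d h q (c i * h), v)) (interpVelocity d h q (c i * h))),
      fun i => (interpVelocity d h q (c i * h),
        fderiv ℝ (fun x => L (x, interpVelocity d h q (c i * h))) (interpCurve d h q (c i * h))),
      fun i => ⟨rfl, rfl⟩, fun i => ?_, ?_⟩
    · refine Prod.ext ((hpos.1 i).trans ?_) ((hmom.1 i).trans ?_) <;>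
        simp [Prod.fst_sum, Prod.snd_sum]
    · refine Prod.ext (hpos.2.trans ?_) (hmom.2.trans ?_) <;>
        simp [Prod.fst_sum, Prod.snd_sum]
  · rintro ⟨Y, K, hF, hY, hy⟩
    obtain ⟨q, h0, h1, hQ, hV⟩ := (exists_interpolation_iff hs hd hd0 hd1 hc hh y₀.1 y₁.1
      (fun i => (Y i).1) (fun i => (K i).1)).2
      ⟨fun i => by rw [hY i]; simp [Prod.fst_sum], by rw [hy]; simp [Prod.fst_sum]⟩
    refine ⟨q, h0, h1, (hG.boundary_equations_iff_dual hs hd hd0 hd1 h y₀.2 y₁.2 _ _ _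
      (discreteLagrangianPartial_eq d b c hL hh q)).2 ?_⟩
    simp only [hQ, hV, ← (hF _).1, ← (hF _).2]
    exact ⟨fun i => by rw [hY i]; simp [Prod.snd_sum], by rw [hy]; simp [Prod.snd_sum]⟩

end IsGaussQuadrature

end Equivalence

/-! ### The harmonic oscillator -/

theorem differentiable_oscillatorLagrangian (ω : ℝ) : Differentiable ℝ (oscillatorLagrangian ω) := by
  unfold oscillatorLagrangian
  fun_prop

theorem lagrangianSystem_oscillator_iff (ω : ℝ) (y k : ℝ × (ℝ →L[ℝ] ℝ)) :
    lagrangianSystem (oscillatorLagrangian ω) y k ↔ y.2 1 = k.1 ∧ k.2 1 = -ω ^ 2 * y.1 := by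
  have h1 : fderiv ℝ (fun v => oscillatorLagrangian ω (y.1, v)) k.1 1 = k.1 := by
    have h : HasDerivAt (fun v => oscillatorLagrangian ω (y.1, v))
        (1 / 2 * (2 * k.1)) k.1 := by
      exact (((hasDerivAt_pow 2 k.1).const_mul (1 / 2)).sub_const
        (1 / 2 * ω ^ 2 * y.1 ^ 2)).congr_deriv (by norm_num)
    rw [fderiv_apply_one_eq_deriv, h.deriv]
    ring
  have h2 : fderiv ℝ (fun q => oscillatorLagrangian ω (q, k.1)) y.1 1 = -ω ^ 2 * y.1 := by
    have h : HasDerivAt (fun q => oscillatorLagrangian ω (q, k.1))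
        (-(1 / 2 * ω ^ 2 * (2 * y.1))) y.1 := by
      exact (((hasDerivAt_pow 2 y.1).const_mul (1 / 2 * ω ^ 2)).const_sub
        (1 / 2 * k.1 ^ 2)).congr_deriv (by norm_num)
    rw [fderiv_apply_one_eq_deriv, h.deriv]
    ring
  unfold lagrangianSystem
  constructor
  · rintro ⟨e1, e2⟩
    exact ⟨by rw [e1, h1], by rw [e2, h2]⟩
  · rintro ⟨e1, e2⟩
    exact ⟨ContinuousLinearMap.ext_ring (by rw [e1, h1]),
      ContinuousLinearMap.ext_ring (by rw [e2, h2])⟩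

/-- In the complex coordinate `p + i ω q`, a Runge-Kutta step for the harmonic oscillator is a step
for the test equation `y' = i ω y`. -/
theorem RungeKutta.step_oscillator_iff {s : ℕ} (Φ : RungeKutta s) {ω : ℝ} (hω : ω ≠ 0) (h : ℝ)
    (q₀ q₁ : ℝ) (p₀ p₁ : ℝ →L[ℝ] ℝ) :
    Φ.Step (lagrangianSystem (oscillatorLagrangian ω)) h (q₀, p₀) (q₁, p₁) ↔
      ∃ Y : Fin s → ℂ,
        (∀ i, Y i = ⟨p₀ 1, ω * q₀⟩ + ∑ j, (Φ.A i j : ℂ) * (⟨0, h * ω⟩ * Y j)) ∧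
        (⟨p₁ 1, ω * q₁⟩ : ℂ) = ⟨p₀ 1, ω * q₀⟩ + ∑ j, (Φ.b j : ℂ) * (⟨0, h * ω⟩ * Y j) := by
  have hre : ∀ (a : Fin s → ℝ) (Y : Fin s → ℂ),
      (∑ j, (a j : ℂ) * (⟨0, h * ω⟩ * Y j)).re = h * ∑ j, a j * (-ω * (Y j).im) := fun a Y => by
    rw [Complex.re_sum, Finset.mul_sum]
    refine Finset.sum_congr rfl fun j _ => ?_
    rw [Complex.re_ofReal_mul, Complex.mul_re]
    ring
  have him : ∀ (a : Fin s → ℝ) (Y : Fin s → ℂ),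
      (∑ j, (a j : ℂ) * (⟨0, h * ω⟩ * Y j)).im = ω * (h * ∑ j, a j * (Y j).re) := fun a Y => by
    rw [Complex.im_sum, Finset.mul_sum, Finset.mul_sum]
    refine Finset.sum_congr rfl fun j _ => ?_
    rw [Complex.im_ofReal_mul, Complex.mul_im]
    ring
  constructor
  · rintro ⟨Y, K, hF, hY, hy⟩
    simp only [lagrangianSystem_oscillator_iff] at hF
    have key : ∀ (a : Fin s → ℝ) (y : ℝ × (ℝ →L[ℝ] ℝ)),
        y = (q₀, p₀) + h • ∑ j, a j • K j → (⟨y.2 1, ω * y.1⟩ : ℂ) = ⟨p₀ 1, ω * q₀⟩ +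
          ∑ j, (a j : ℂ) * (⟨0, h * ω⟩ * ⟨(Y j).2 1, ω * (Y j).1⟩) := by
      rintro a y rfl
      apply Complex.ext
      · rw [Complex.add_re, hre]
        simp [Prod.snd_sum, (hF _).2, pow_two, mul_assoc]
      · rw [Complex.add_im, him]
        simp [Prod.fst_sum, (hF _).1, mul_add]
    exact ⟨fun i => ⟨(Y i).2 1, ω * (Y i).1⟩, fun i => key _ _ (hY i), key _ _ hy⟩
  · rintro ⟨Y, hY, hy⟩
    have key : ∀ (a : Fin s → ℝ) (y : ℂ) (q : ℝ) (p : ℝ →L[ℝ] ℝ), p 1 = y.re → ω * q = y.im →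
        y = ⟨p₀ 1, ω * q₀⟩ + ∑ j, (a j : ℂ) * (⟨0, h * ω⟩ * Y j) →
        (q, p) = (q₀, p₀) + h • ∑ j, a j •
          (((Y j).re, (-ω * (Y j).im) • ContinuousLinearMap.id ℝ ℝ) : ℝ × (ℝ →L[ℝ] ℝ)) := by
      rintro a y q p hp hq rfl
      rw [Complex.add_re, hre] at hp
      rw [Complex.add_im, him] at hq
      refine Prod.ext (mul_left_cancel₀ hω (hq.trans ?_))
        (ContinuousLinearMap.ext_ring (hp.trans ?_))
      · simp [Prod.fst_sum, mul_add]
      · simp [Prod.snd_sum]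
    -- Inverts `Y = p + i ω q`, with slopes read off from `q' = p` and `p' = -ω² q = -ω Im Y`.
    refine ⟨fun i => ((Y i).im / ω, (Y i).re • ContinuousLinearMap.id ℝ ℝ),
      fun i => ((Y i).re, (-ω * (Y i).im) • ContinuousLinearMap.id ℝ ℝ), fun i => ?_,
      fun i => key _ (Y i) _ _ (by simp) (by field_simp) (hY i), key _ _ _ _ rfl rfl hy⟩
    rw [lagrangianSystem_oscillator_iff]
    refine ⟨by simp, ?_⟩
    simp
    field_simp

theorem mainTheorem2 (s : ℕ) (hs : 1 ≤ s)
    (d : Fin (s + 1) → ℝ) (hd : StrictMono d) (hd0 : d 0 = 0) (hd1 : d (Fin.last s) = 1)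
    (b c : Fin s → ℝ) (hG : IsGaussQuadrature b c) :
    (VariationalEquivalent d b c (collocation c) ∧ (collocation c).IsAStable) ∧
    (∀ ω : ℝ, ω ≠ 0 → ∀ h : ℝ, h ≠ 0 →
      ∃ M ∈ Matrix.orthogonalGroup (Fin 2) ℝ,
        ∀ (q₀ q₁ : ℝ) (p₀ p₁ : ℝ →L[ℝ] ℝ),
          VariationalStep d b c (oscillatorLagrangian ω) h (q₀, p₀) (q₁, p₁) ↔
            ![p₁ 1, ω * q₁] = M.mulVec ![p₀ 1, ω * q₀]) := by
  refine ⟨⟨fun E _ _ _ L hL h hh y₀ y₁ => hG.variationalStep_iff hs hd.injective hd0 hd1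
    (hL.differentiable two_ne_zero) hh y₀ y₁, hG.collocation_isAStable hs⟩, fun ω hω h hh => ?_⟩
  obtain ⟨R, -, hR, hstep⟩ := hG.exists_stability_value hs (z := ⟨0, h * ω⟩) le_rfl
  have hR' : R.re * R.re + R.im * R.im = 1 := by
    rw [← Complex.normSq_apply, Complex.normSq_eq_norm_sq, hR rfl, one_pow]
  -- The real matrix of multiplication by `R`, orthogonal because `|R| = 1` when `z` is imaginary,
  -- whatever the sign of `h`.
  refine ⟨!![R.re, -R.im; R.im, R.re], ?_, fun q₀ q₁ p₀ p₁ => ?_⟩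
  · rw [Matrix.mem_orthogonalGroup_iff]
    ext i j
    fin_cases i <;> fin_cases j <;> simp [Matrix.mul_apply, Fin.sum_univ_two] <;> linarith
  · rw [hG.variationalStep_iff hs hd.injective hd0 hd1 (differentiable_oscillatorLagrangian ω) hh,
      RungeKutta.step_oscillator_iff _ hω, hstep, Complex.ext_iff, Complex.mul_re, Complex.mul_im]
    simp only [Matrix.mulVec_eq_sum, funext_iff, Fin.forall_fin_two]
    simp [mul_comm, sub_eq_add_neg, add_comm]
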